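/- Theorem 2.8. Let $\alpha>0$, let $X_{0-}$ be a real random variable, and let $Z=(Z_t)_{t\ge 0}$ be a continuous real-valued process with $Z_0=0$, independent of $X_{0-}$, which has the crossing property: for every $h>0$ and every stopping time $\tau$ of the natural filtration of $X_{0-}+Z$, $$\mathbb P\Big(\tau<\infty,\ \inf_{0\le s\le h}(Z_{\tau+s}-Z_\tau)=0\Big)=0 .$$ A solution of the McKean–Vlasov problem (the probabilistic supercooled Stefan problem) is a triple $(X,\tau,\Lambda)$ with $$X_t=X_{0-}+Z_t-\Lambda_t,\qquad \tau=\inf\{t\ge 0: X_t\le 0\},\qquad \Lambda_t=\alpha\,\mathbb P(\tau\le t)\qquad (t\ge 0).$$ Let $M$ be the set of increasing càdlàg functions $\ell:[-\infty,\infty]\to[0,1]$ with $\ell_{0-}=0$ and $\ell_\infty=1$, where $\ell^n\to\ell$ in $M$ means that $\ell^n_t\to\ell_t$ for every $t\in[0,\infty]$ at which $\ell$ is continuous. For $\Delta>0$ and $\ell\in M$ put $$X^\Delta_t[\ell]=X_{0-}+Z_{\lfloor t/\Delta\rfloor\Delta}-\alpha\,\ell_{\lfloor t/\Delta\rfloor\Delta},\qquad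 \tau^\Delta[\ell]=\inf\{t\ge 0:X^\Delta_t[\ell]\le 0\},\qquad \Gamma_\Delta[\ell]_t=\mathbb P(\tau^\Delta[\ell]\le t).$$ A solution of the discretized McKean–Vlasov problem (implicit time-stepping scheme) with step $\Delta$ is a function $\Lambda^\Delta$ with $\alpha^{-1}\Lambda^\Delta\in M$ and $\alpha\,\Gamma_\Delta[\alpha^{-1}\Lambda^\Delta]=\Lambda^\Delta$. In either problem, a solution is called minimal if its $\Lambda$-component is, at every time $t\ge 0$, at most the $\Lambda$-component of every other solution of that problem. Let $\Delta_n>0$ with $\Delta_n\to 0$ and $\Delta_n\mathbb N\subseteq\Delta_{n+1}\mathbb N$ for all $n$. Assume that either $\operatorname{law}(X_{0-})$ is atomless, or $\operatorname{law}(Z_t)$ is atomless for every $t>0$. Then the McKean–Vlasov problem and, for every $n$, the discretized problem with step $\Delta_n$ have unique minimal solutions $\underline\Lambda$ and $\underline\Lambda^{\Delta_n}$, and $$\lim_{n\to\infty}\underline\Lambda^{\Delta_n}=\underline\Lambda\quad\text{in } M,$$ that is, $\alpha^{-1}\underline\Lambda^{\Delta_n}\to\alpha^{-1}\underline\Lambda$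 in $M$ (a function on $[0,\infty)$ being extended by $0$ to $[-\infty,0)$ and by $1$ to $\infty$ after multiplication by $\alpha^{-1}$). -/

import Mathlib

open MeasureTheory ProbabilityTheory Filter Topology
open scoped NNReal ENNReal

namespace Stefan

/-- The space `M` of cumulative distribution functions on `[0, ∞]`: increasing càdlàg functions
`ℓ` from the two-point compactification of `ℝ` to `[0, 1]` with `ℓ_{0-} = 0` and `ℓ_∞ = 1`.
(Left limits exist automatically by monotonicity; for an increasing function with values in
`[0, 1]`, the condition `ℓ_{0-} = 0` says that `ℓ` vanishes on `[-∞, 0)`.) -/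
structure DistFun where
  toFun : EReal → ℝ
  mem_Icc : ∀ t, toFun t ∈ Set.Icc (0 : ℝ) 1
  mono : Monotone toFun
  right_cont : ∀ t, ContinuousWithinAt toFun (Set.Ici t) t
  eq_zero_of_neg : ∀ t, t < 0 → toFun t = 0
  top_eq_one : toFun ⊤ = 1

/-- The value `ℓ_t` at a finite time `t ≥ 0`. -/
def DistFun.val (ℓ : DistFun) (t : ℝ≥0) : ℝ := ℓ.toFun ((t : ℝ) : EReal)

/-- Convergence in `M` (Lévy topology): `ℓⁿ_t → ℓ_t` for every `t ∈ [0, ∞]` at which `ℓ`,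
as a function on the extended real line, is continuous. In particular `0` counts as a continuity
point exactly when `ℓ_0 = ℓ_{0-} = 0`. -/
def ConvergesInM (ℓs : ℕ → DistFun) (ℓ : DistFun) : Prop :=
  ∀ t : EReal, 0 ≤ t → ContinuousAt ℓ.toFun t →
    Tendsto (fun n => (ℓs n).toFun t) atTop (𝓝 (ℓ.toFun t))

/-- The hitting time `inf {t ≥ 0 : x_t ≤ 0} ∈ [0, ∞]`, equal to `∞` if there is no such `t`. -/
noncomputable def hittingTime (x : ℝ≥0 → ℝ) : ℝ≥0∞ :=
  sInf {s : ℝ≥0∞ | ∃ t : ℝ≥0, s = (t : ℝ≥0∞) ∧ x t ≤ 0}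

variable {Ω : Type*} [MeasurableSpace Ω]

/-- The crossing property of `Z`: for every stopping time `τ` of the natural filtration of
`X_{0-} + Z` and every `h > 0`,
`P (τ < ∞, inf_{0 ≤ s ≤ h} (Z_{τ+s} - Z_τ) = 0) = 0`. -/
def CrossingProperty (P : Measure Ω) (X₀ : Ω → ℝ) (Z : ℝ≥0 → Ω → ℝ)
    (hX₀ : Measurable X₀) (hZ : ∀ t, Measurable (Z t)) : Prop :=
  ∀ τ : Ω → WithTop ℝ≥0,
    IsStoppingTime
      (Filtration.natural (fun t ω => X₀ ω + Z t ω)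
        (fun t => (hX₀.add (hZ t)).stronglyMeasurable)) τ →
    ∀ h : ℝ≥0, 0 < h →
      P {ω | ∃ t : ℝ≥0, τ ω = (t : WithTop ℝ≥0) ∧
        ⨅ s : Set.Icc (0 : ℝ≥0) h, (Z (t + (s : ℝ≥0)) ω - Z t ω) = 0} = 0

/-- `(X, τ, Λ)` solves the McKean–Vlasov problem
`X_t = X_{0-} + Z_t - Λ_t`, `τ = inf {t ≥ 0 : X_t ≤ 0}`, `Λ_t = α P(τ ≤ t)`, for `t ≥ 0`.
The time `τ` is a random variable, so that its law makes sense. -/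
structure IsMVSolution (P : Measure Ω) (X₀ : Ω → ℝ) (Z : ℝ≥0 → Ω → ℝ) (α : ℝ)
    (X : ℝ≥0 → Ω → ℝ) (τ : Ω → ℝ≥0∞) (Λ : ℝ≥0 → ℝ) : Prop where
  state_eq : ∀ t ω, X t ω = X₀ ω + Z t ω - Λ t
  hitting_eq : ∀ ω, τ ω = hittingTime (fun t => X t ω)
  measurable_hitting : Measurable τ
  loss_eq : ∀ t : ℝ≥0, Λ t = α * P.real {ω | τ ω ≤ (t : ℝ≥0∞)}

/-- `Λ` is (the free boundary component of) the minimal solution of the McKean–Vlasov problem. -/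
def IsMinimalMVSolution (P : Measure Ω) (X₀ : Ω → ℝ) (Z : ℝ≥0 → Ω → ℝ) (α : ℝ)
    (Λ : ℝ≥0 → ℝ) : Prop :=
  (∃ X τ, IsMVSolution P X₀ Z α X τ Λ) ∧
    ∀ X' τ' Λ', IsMVSolution P X₀ Z α X' τ' Λ' → ∀ t, Λ t ≤ Λ' t

/-- The last point `⌊t/Δ⌋ Δ` of the grid `Δ ℕ` before or at time `t`. -/
noncomputable def gridFloor (Δ t : ℝ≥0) : ℝ≥0 := (⌊t / Δ⌋₊ : ℝ≥0) * Δ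

/-- `Γ_Δ[ℓ]_t = P(τ^Δ[ℓ] ≤ t)`, where `τ^Δ[ℓ]` is the hitting time of `(-∞, 0]` by
`X^Δ_t[ℓ] = X_{0-} + Z_{⌊t/Δ⌋Δ} - α ℓ_{⌊t/Δ⌋Δ}`. -/
noncomputable def discreteGamma (P : Measure Ω) (X₀ : Ω → ℝ) (Z : ℝ≥0 → Ω → ℝ) (α : ℝ)
    (Δ : ℝ≥0) (ℓ : DistFun) (t : ℝ≥0) : ℝ :=
  P.real {ω | hittingTime
    (fun s => X₀ ω + Z (gridFloor Δ s) ω - α * ℓ.val (gridFloor Δ s)) ≤ (t : ℝ≥0∞)}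

/-- `Λ` solves the discretized McKean–Vlasov problem (implicit time-stepping scheme) with step
`Δ`: `α⁻¹ Λ ∈ M` and `α Γ_Δ[α⁻¹ Λ] = Λ`. -/
def IsDiscreteSolution (P : Measure Ω) (X₀ : Ω → ℝ) (Z : ℝ≥0 → Ω → ℝ) (α : ℝ)
    (Δ : ℝ≥0) (Λ : ℝ≥0 → ℝ) : Prop :=
  ∃ ℓ : DistFun, (∀ t, ℓ.val t = α⁻¹ * Λ t) ∧ ∀ t, α * discreteGamma P X₀ Z α Δ ℓ t = Λ t

/-- `Λ` is the minimal solution of the discretized McKean–Vlasov problem with step `Δ`. -/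
def IsMinimalDiscreteSolution (P : Measure Ω) (X₀ : Ω → ℝ) (Z : ℝ≥0 → Ω → ℝ) (α : ℝ)
    (Δ : ℝ≥0) (Λ : ℝ≥0 → ℝ) : Prop :=
  IsDiscreteSolution P X₀ Z α Δ Λ ∧
    ∀ Λ', IsDiscreteSolution P X₀ Z α Δ Λ' → ∀ t, Λ t ≤ Λ' t

end Stefan

/-! Solutions of either problem are `α` times the fixed points, among distribution functions on `[0,
∞)`, of a monotone operator. Knaster-Tarski yields a least fixed point that is also the least
supersolution (`exists_least_fixedPoint`).

Observing a path at fewer times delays its hitting. Hence the continuous minimal solution is a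
supersolution on every grid, and a solution on a finer grid is a supersolution on a coarser one. The
discrete minimal solutions therefore increase and stay below the continuous one.

Conversely, let `F` be the right-continuous modification of their supremum. By the crossing
property, a path that has met `α F` soon drops strictly below the boundary's level at the hitting
time. By continuity it is still below that level at a nearby grid point, where it also lies below a
discrete boundary of large index. So `F` is a supersolution (`lossOperator_iInf_iSup_le`) and
dominates the minimal solution, which forces convergence at continuity points. -/

namespace Stefan

/-! ### Distribution functions and least fixed points -/

/-- Increasing right-continuous functions `[0, ∞) → [0, 1]`. -/
structure IsCdf (f : ℝ≥0 → ℝ) : Prop where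
  mono : Monotone f
  nonneg : ∀ t, 0 ≤ f t
  le_one : ∀ t, f t ≤ 1
  exists_gt : ∀ t c, f t < c → ∃ u, t < u ∧ f u < c

theorem IsCdf.eventually_lt {f : ℝ≥0 → ℝ} (hf : IsCdf f) {t : ℝ≥0} {c : ℝ} (h : f t < c) :
    ∀ᶠ s in 𝓝 t, f s < c := by
  obtain ⟨u, htu, hu⟩ := hf.exists_gt t c h
  filter_upwards [Iio_mem_nhds htu] with s hs
  exact (hf.mono (le_of_lt hs)).trans_lt hu

theorem isCdf_one : IsCdf (fun _ => 1) where
  mono := monotone_const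
  nonneg _ := zero_le_one
  le_one _ := le_rfl
  exists_gt t _ h := ⟨t + 1, lt_add_one t, h⟩

/-- An infimum below `c` has a member below `c`, so right continuity in the one-sided form
`exists_gt` survives arbitrary infima. -/
theorem IsCdf.iInf {ι : Type*} [Nonempty ι] {f : ι → ℝ≥0 → ℝ} (hf : ∀ i, IsCdf (f i)) :
    IsCdf (fun t => ⨅ i, f i t) := by
  have hb : ∀ t, BddBelow (Set.range fun i => f i t) := fun t =>
    ⟨0, by rintro _ ⟨i, rfl⟩; exact (hf i).nonneg t⟩
  refine ⟨fun s t hst => ciInf_mono (hb s) fun i => (hf i).mono hst,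
    fun t => le_ciInf fun i => (hf i).nonneg t, fun t => ?_, fun t c h => ?_⟩
  · obtain ⟨i⟩ := ‹Nonempty ι›
    exact (ciInf_le (hb t) i).trans ((hf i).le_one t)
  · obtain ⟨i, hi⟩ := exists_lt_of_ciInf_lt h
    obtain ⟨u, htu, hu⟩ := (hf i).exists_gt t c hi
    exact ⟨u, htu, (ciInf_le (hb u) i).trans_lt hu⟩

/-- The right-continuous modification of an increasing function is a distribution function. -/
theorem isCdf_iInf_Ioi {m : ℝ≥0 → ℝ} (h0 : ∀ t, 0 ≤ m t) (h1 : ∀ t, m t ≤ 1) :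
    IsCdf (fun t : ℝ≥0 => ⨅ u : Set.Ioi t, m (u : ℝ≥0)) := by
  have hb : ∀ t : ℝ≥0, BddBelow (Set.range fun u : Set.Ioi t => m (u : ℝ≥0)) := fun t =>
    ⟨0, by rintro _ ⟨i, rfl⟩; exact h0 _⟩
  have hne : ∀ t : ℝ≥0, Nonempty (Set.Ioi t) := fun t => ⟨⟨t + 1, lt_add_one t⟩⟩
  refine ⟨fun s t hst => ?_, fun t => ?_, fun t => ?_, fun t c h => ?_⟩
  · have := hne t
    exact le_ciInf fun u => ciInf_le (hb s) ⟨u, hst.trans_lt u.2⟩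
  · exact le_ciInf (fun _ => h0 _)
  · exact (ciInf_le (hb t) ⟨t + 1, lt_add_one t⟩).trans (h1 _)
  · obtain ⟨⟨u, hu⟩, huc⟩ := exists_lt_of_ciInf_lt h
    obtain ⟨v, htv, hvu⟩ := exists_between (show t < u from hu)
    exact ⟨v, htv, (ciInf_le (hb v) ⟨u, hvu⟩).trans_lt huc⟩

/-- A Knaster-Tarski theorem for monotone operators on distribution functions. -/
theorem exists_least_fixedPoint {Γ : (ℝ≥0 → ℝ) → ℝ≥0 → ℝ}
    (hΓ : ∀ f, IsCdf f → IsCdf (Γ f))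
    (hmono : ∀ f g, IsCdf f → IsCdf g → f ≤ g → Γ f ≤ Γ g) :
    ∃ f, IsCdf f ∧ Γ f = f ∧ ∀ g, IsCdf g → Γ g ≤ g → f ≤ g := by
  let ι := {g : ℝ≥0 → ℝ // IsCdf g ∧ Γ g ≤ g}
  have : Nonempty ι := ⟨⟨fun _ => 1, isCdf_one, (hΓ _ isCdf_one).le_one⟩⟩
  let f : ℝ≥0 → ℝ := fun t => ⨅ g : ι, g.1 t
  have hf : IsCdf f := IsCdf.iInf fun g : ι => g.2.1
  have hle : ∀ g, IsCdf g → Γ g ≤ g → f ≤ g := fun g hg hgg t =>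
    ciInf_le (f := fun g : ι => g.1 t) ⟨0, by rintro _ ⟨i, rfl⟩; exact i.2.1.nonneg t⟩ ⟨g, hg, hgg⟩
  -- For each supersolution `g`, `Γ f ≤ Γ g ≤ g`; taking the infimum over `g` makes `f` a
  -- supersolution, and then `Γ f` is one too.
  have hsup : Γ f ≤ f := fun t => le_ciInf fun g : ι =>
    (hmono f g.1 hf g.2.1 (hle g.1 g.2.1 g.2.2) t).trans (g.2.2 t)
  exact ⟨f, hf, le_antisymm hsup (hle _ (hΓ f hf) (hmono _ _ (hΓ f hf) hf hsup)), hle⟩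

/-- The extension of a distribution function on `[0, ∞)` to `[-∞, ∞]`. -/
noncomputable def IsCdf.toDistFun {f : ℝ≥0 → ℝ} (hf : IsCdf f) : DistFun where
  toFun t := if t < 0 then 0 else if t = ⊤ then 1 else f t.toReal.toNNReal
  mem_Icc t := by
    split_ifs
    · simp
    · simp
    · exact ⟨hf.nonneg _, hf.le_one _⟩
  mono s t hst := by
    dsimp only
    by_cases hs : s < 0
    · rw [if_pos hs]
      split_ifs
      · exact le_rfl
      · exact zero_le_one
      · exact hf.nonneg _
    · have ht : ¬ t < 0 := fun h => hs (hst.trans_lt h)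
      rw [if_neg hs, if_neg ht]
      by_cases ht' : t = ⊤
      · rw [if_pos ht']
        split_ifs
        · exact le_rfl
        · exact hf.le_one _
      · have hs' : s ≠ ⊤ := fun h => ht' (top_le_iff.1 (h ▸ hst))
        rw [if_neg ht', if_neg hs']
        refine hf.mono (Real.toNNReal_le_toNNReal (EReal.toReal_le_toReal hst ?_ ht'))
        rintro rfl
        exact hs EReal.bot_lt_zero
  right_cont t := by
    by_cases ht : t < 0
    · refine ContinuousAt.continuousWithinAt ?_
      refine (continuousAt_const (y := (0 : ℝ))).congr ?_
      filter_upwards [Iio_mem_nhds ht] with s hs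
      rw [if_pos (show s < 0 from hs)]
    by_cases ht' : t = ⊤
    · subst ht'
      -- Nothing lies to the right of `⊤`, so `f` need not tend to `1` at infinity.
      rw [Set.Ici_top]
      exact continuousWithinAt_singleton
    have hbot : t ≠ ⊥ := by
      rintro rfl
      exact ht EReal.bot_lt_zero
    rw [ContinuousWithinAt, if_neg ht, if_neg ht']
    refine tendsto_order.2 ⟨fun c hc => ?_, fun c hc => ?_⟩
    · filter_upwards [self_mem_nhdsWithin] with s hs
      have hs0 : ¬ s < 0 := fun h => ht (lt_of_le_of_lt hs h)
      rw [if_neg hs0]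
      split_ifs with hs'
      · exact hc.trans_le (hf.le_one _)
      · exact hc.trans_le (hf.mono (Real.toNNReal_le_toNNReal (EReal.toReal_le_toReal hs hbot hs')))
    · have h1 := (continuous_real_toNNReal.continuousAt.comp
        (EReal.tendsto_toReal ht' hbot : ContinuousAt EReal.toReal t)).eventually
          (hf.eventually_lt hc)
      filter_upwards [self_mem_nhdsWithin, mem_nhdsWithin_of_mem_nhds h1,
        mem_nhdsWithin_of_mem_nhds (Iio_mem_nhds (lt_top_iff_ne_top.2 ht'))] with s hs h2 h3
      have hs0 : ¬ s < 0 := fun h => ht (lt_of_le_of_lt hs h)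
      rw [if_neg hs0, if_neg (ne_of_lt h3)]
      exact h2
  eq_zero_of_neg t ht := if_pos ht
  top_eq_one := by simp

@[simp]
theorem IsCdf.toDistFun_val {f : ℝ≥0 → ℝ} (hf : IsCdf f) : hf.toDistFun.val = f := by
  funext t
  have h : ¬ (((t : ℝ) : EReal) < 0) := not_lt.2 (EReal.coe_nonneg.2 t.2)
  simp [DistFun.val, IsCdf.toDistFun, h]

theorem DistFun.isCdf_val (ℓ : DistFun) : IsCdf ℓ.val where
  mono s t hst := ℓ.mono (EReal.coe_le_coe_iff.2 (NNReal.coe_le_coe.2 hst))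
  nonneg t := (ℓ.mem_Icc _).1
  le_one t := (ℓ.mem_Icc _).2
  exists_gt t c h := by
    have hT : Tendsto (fun s : ℝ≥0 => ((s : ℝ) : EReal)) (𝓝[>] t)
        (𝓝[≥] (((t : ℝ) : EReal))) := by
      refine tendsto_nhdsWithin_of_tendsto_nhds_of_eventually_within _
        ((continuous_coe_real_ereal.comp NNReal.continuous_coe).continuousWithinAt) ?_
      filter_upwards [self_mem_nhdsWithin] with s hs
      exact EReal.coe_le_coe_iff.2 (NNReal.coe_le_coe.2 (le_of_lt hs))
    have h2 := (((ℓ.right_cont _).tendsto.comp hT).eventually_lt_const h).and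
      (self_mem_nhdsWithin (s := Set.Ioi t))
    obtain ⟨u, hu, htu⟩ := h2.exists
    exact ⟨u, htu, hu⟩

theorem isCdf_measureReal_le {Ω : Type*} [MeasurableSpace Ω] (P : Measure Ω)
    [IsProbabilityMeasure P] {τ : Ω → ℝ≥0∞} (hτ : Measurable τ) :
    IsCdf (fun t => P.real {ω | τ ω ≤ (t : ℝ≥0∞)}) where
  mono s t hst := measureReal_mono fun ω (h : τ ω ≤ s) => h.trans (ENNReal.coe_le_coe.2 hst)
  nonneg _ := measureReal_nonneg
  le_one _ := measureReal_le_one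
  exists_gt t c h := by
    have hT := tendsto_measure_biInter_gt (μ := P)
      (s := fun t : ℝ≥0 => {ω | τ ω ≤ (t : ℝ≥0∞)}) (a := t)
      (fun r _ => (measurableSet_le hτ measurable_const).nullMeasurableSet)
      (fun i j _ hij ω (h : τ ω ≤ i) => h.trans (ENNReal.coe_le_coe.2 hij))
      ⟨t + 1, lt_add_one t, measure_ne_top _ _⟩
    have heq : (⋂ r > t, {ω | τ ω ≤ ((r : ℝ≥0) : ℝ≥0∞)}) = {ω | τ ω ≤ (t : ℝ≥0∞)} := by
      ext ω
      simp only [Set.mem_iInter, Set.mem_ofPred_eq]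
      refine ⟨fun H => le_of_forall_gt_imp_ge_of_dense fun a ha => ?_,
        fun H r hr => H.trans (ENNReal.coe_le_coe.2 (le_of_lt hr))⟩
      induction a with
      | top => exact le_top
      | coe a => exact H a (ENNReal.coe_lt_coe.1 ha)
    rw [heq] at hT
    have hT' := (ENNReal.tendsto_toReal (measure_ne_top P _)).comp hT
    obtain ⟨u, hu, htu⟩ := ((hT'.eventually_lt_const h).and self_mem_nhdsWithin).exists
    exact ⟨u, htu, hu⟩

/-! ### Hitting times of paths and of their grid samples -/

theorem hittingTime_le_of_le {x : ℝ≥0 → ℝ} {t : ℝ≥0} (h : x t ≤ 0) : hittingTime x ≤ t :=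
  sInf_le ⟨t, rfl, h⟩

theorem hittingTime_anti {x y : ℝ≥0 → ℝ} (h : ∀ t, y t ≤ x t) : hittingTime y ≤ hittingTime x :=
  sInf_le_sInf fun _ ⟨t, hs, ht⟩ => ⟨t, hs, (h t).trans ht⟩

/-- If `x > 0` on `[0, t]`, lower semicontinuity at `t` keeps it positive up to some `u > t`, so the
hitting time is at least `u`. -/
theorem hittingTime_le_iff {x : ℝ≥0 → ℝ} (hx : LowerSemicontinuous x) (t : ℝ≥0) :
    hittingTime x ≤ t ↔ ∃ s ≤ t, x s ≤ 0 := by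
  refine ⟨fun h => ?_, fun ⟨s, hst, hs⟩ =>
    (hittingTime_le_of_le hs).trans (ENNReal.coe_le_coe.2 hst)⟩
  by_contra! hc
  have hev := hx t 0 (hc t le_rfl)
  obtain ⟨u, htu, hu⟩ := exists_Ico_subset_of_mem_nhds hev ⟨t + 1, lt_add_one t⟩
  refine absurd h (not_le.2 (lt_of_lt_of_le (ENNReal.coe_lt_coe.2 htu) (le_sInf ?_)))
  rintro _ ⟨s, rfl, hs⟩
  refine ENNReal.coe_le_coe.2 (not_lt.1 fun hsu => ?_)
  rcases le_or_gt s t with hst | hst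
  · exact absurd hs (not_le.2 (hc s hst))
  · exact absurd hs (not_le.2 (hu ⟨hst.le, hsu⟩))

theorem gridFloor_le {Δ : ℝ≥0} (hΔ : 0 < Δ) (t : ℝ≥0) : gridFloor Δ t ≤ t :=
  (le_div_iff₀ hΔ).1 (Nat.floor_le (zero_le : 0 ≤ t / Δ))

theorem gridFloor_natCast_mul {Δ : ℝ≥0} (hΔ : 0 < Δ) (k : ℕ) : gridFloor Δ (k * Δ) = k * Δ := by
  rw [gridFloor, mul_div_cancel_right₀ _ hΔ.ne', Nat.floor_natCast]

theorem lt_floor_add_one_mul {Δ : ℝ≥0} (hΔ : 0 < Δ) (t : ℝ≥0) :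
    t < ((⌊t / Δ⌋₊ + 1 : ℕ) : ℝ≥0) * Δ := by
  rw [← div_lt_iff₀ hΔ, Nat.cast_add_one]
  exact Nat.lt_floor_add_one _

theorem hittingTime_gridFloor_le_iff {Δ : ℝ≥0} (hΔ : 0 < Δ) (x : ℝ≥0 → ℝ) (t : ℝ≥0) :
    hittingTime (fun s => x (gridFloor Δ s)) ≤ t ↔ ∃ k : ℕ, k * Δ ≤ t ∧ x (k * Δ) ≤ 0 := by
  refine ⟨fun h => ?_, fun ⟨k, hkt, hk⟩ => ?_⟩
  · by_contra! hc
    refine absurd h (not_le.2 (lt_of_lt_of_le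
      (ENNReal.coe_lt_coe.2 (lt_floor_add_one_mul hΔ t)) (le_sInf ?_)))
    rintro _ ⟨s, rfl, hs⟩
    refine ENNReal.coe_le_coe.2 (le_trans ?_ (gridFloor_le hΔ s))
    have hlt : t < gridFloor Δ s := not_le.1 fun hle => absurd hs (not_le.2 (hc _ hle))
    have h2 : ⌊t / Δ⌋₊ + 1 ≤ ⌊s / Δ⌋₊ := by
      have h3 : t / Δ < (⌊s / Δ⌋₊ : ℝ≥0) := (div_lt_iff₀ hΔ).2 hlt
      exact Nat.succ_le_of_lt ((Nat.floor_lt zero_le).2 h3)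
    exact mul_le_mul_of_nonneg_right (Nat.cast_le.2 h2) zero_le
  · refine (hittingTime_le_of_le (t := k * Δ) ?_).trans (ENNReal.coe_le_coe.2 hkt)
    rwa [gridFloor_natCast_mul hΔ]

theorem exists_natCast_mul_mem_Ioo {Δ a b : ℝ≥0} (hΔ : 0 < Δ) (hab : a + Δ < b) :
    ∃ k : ℕ, a < k * Δ ∧ k * Δ < b := by
  refine ⟨_, lt_floor_add_one_mul hΔ a, lt_of_le_of_lt ?_ hab⟩
  rw [Nat.cast_add_one, add_mul, one_mul]
  gcongr
  exact gridFloor_le hΔ a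

/-! ### Measurability of hitting times -/

variable {Ω : Type*}

/-- An increasing right-continuous function is upper semicontinuous. -/
theorem lowerSemicontinuous_sub {α : ℝ} (hα : 0 < α) {y f : ℝ≥0 → ℝ} (hy : Continuous y)
    (hf : IsCdf f) : LowerSemicontinuous (fun s => y s - α * f s) := by
  refine fun t c (hc : c < y t - α * f t) => ?_
  obtain ⟨d, hd1, hd2⟩ := exists_between (lt_sub_comm.1 hc)
  have h1 : f t < d / α := (lt_div_iff₀' hα).2 hd1
  have h2 : ∀ᶠ s in 𝓝 t, c + d < y s :=
    hy.continuousAt.eventually_const_lt (by linarith)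
  filter_upwards [hf.eventually_lt h1, h2] with s hs1 hs2
  have := (lt_div_iff₀' hα).1 hs1
  linarith

/-- The event that a continuous process has met an increasing right-continuous boundary by time
`t` depends only on the process up to time `t`. -/
theorem measurableSet_hittingTime_le [m : MeasurableSpace Ω] {α : ℝ} (hα : 0 < α)
    {Y : ℝ≥0 → Ω → ℝ} (hcont : ∀ ω, Continuous fun s => Y s ω) {f : ℝ≥0 → ℝ} (hf : IsCdf f)
    (t : ℝ≥0) (hY : ∀ s ≤ t, Measurable (Y s)) :
    MeasurableSet {ω | hittingTime (fun s => Y s ω - α * f s) ≤ t} := by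
  obtain ⟨D, hDc, hDd⟩ := TopologicalSpace.exists_countable_dense ℝ≥0
  -- Reduction to countably many times. A meeting point `s < t` is approximated from the right,
  -- where `f` only grows; `s = t` leaves no such room, hence `insert t D`. Conversely, a lower
  -- semicontinuous function attains its minimum on `[0, t]`.
  have hset : {ω | hittingTime (fun s => Y s ω - α * f s) ≤ t} =
      ⋂ k : ℕ, ⋃ s ∈ insert t D ∩ Set.Iic t, {ω | Y s ω < α * f s + 1 / ((k : ℝ) + 1)} := by
    ext ω
    have hlsc := lowerSemicontinuous_sub hα (hcont ω) hf
    simp only [Set.mem_ofPred_eq, hittingTime_le_iff hlsc, Set.mem_iInter, Set.mem_iUnion,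
      exists_prop]
    constructor
    · rintro ⟨s, hst, hs⟩ k
      have hk : (0 : ℝ) < 1 / ((k : ℝ) + 1) := by positivity
      rcases hst.eq_or_lt with rfl | hst
      · exact ⟨s, ⟨Set.mem_insert _ _, Set.mem_Iic.2 le_rfl⟩, by linarith⟩
      · have hev : ∀ᶠ r in 𝓝 s, Y r ω < Y s ω + 1 / ((k : ℝ) + 1) :=
          (hcont ω).continuousAt.eventually_lt_const (by linarith)
        obtain ⟨v, hsv, hv⟩ := exists_Ico_subset_of_mem_nhds hev ⟨t, hst⟩
        obtain ⟨r, hrD, hr1, hr2⟩ := hDd.exists_between (lt_min hsv hst)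
        refine ⟨r, ⟨Set.mem_insert_of_mem _ hrD, (hr2.trans_le (min_le_right _ _)).le⟩, ?_⟩
        have h1 : Y r ω < Y s ω + 1 / ((k : ℝ) + 1) := hv ⟨hr1.le, hr2.trans_le (min_le_left _ _)⟩
        have h2 := mul_le_mul_of_nonneg_left (hf.mono hr1.le) hα.le
        linarith
    · intro H
      obtain ⟨s, hs, hmin⟩ := (hlsc.lowerSemicontinuousOn (Set.Icc 0 t)).exists_isMinOn
        (Set.nonempty_Icc.2 zero_le) isCompact_Icc
      refine ⟨s, hs.2, le_of_forall_pos_lt_add fun ε hε => ?_⟩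
      obtain ⟨k, hk⟩ := exists_nat_one_div_lt hε
      obtain ⟨r, hr, hlt⟩ := H k
      have := isMinOn_iff.1 hmin r ⟨zero_le, hr.2⟩
      linarith
  rw [hset]
  refine MeasurableSet.iInter fun k => MeasurableSet.biUnion ((hDc.insert t).mono
    Set.inter_subset_left) fun s hs => measurableSet_lt (hY s hs.2) measurable_const

theorem measurable_of_measurableSet_le [MeasurableSpace Ω] {τ : Ω → ℝ≥0∞}
    (h : ∀ t : ℝ≥0, MeasurableSet {ω | τ ω ≤ t}) : Measurable τ := by
  refine measurable_of_Iic fun a => ?_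
  induction a with
  | top => simp
  | coe a => exact h a

theorem measurable_hittingTime [MeasurableSpace Ω] {α : ℝ} (hα : 0 < α)
    {Y : ℝ≥0 → Ω → ℝ} (hcont : ∀ ω, Continuous fun s => Y s ω) (hY : ∀ s, Measurable (Y s))
    {f : ℝ≥0 → ℝ} (hf : IsCdf f) :
    Measurable fun ω => hittingTime (fun s => Y s ω - α * f s) :=
  measurable_of_measurableSet_le fun t =>
    measurableSet_hittingTime_le hα hcont hf t fun s _ => hY s

theorem measurable_hittingTime_gridFloor [MeasurableSpace Ω] {Δ : ℝ≥0} (hΔ : 0 < Δ)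
    {Y : ℝ≥0 → Ω → ℝ} (hY : ∀ s, Measurable (Y s)) :
    Measurable fun ω => hittingTime (fun s => Y (gridFloor Δ s) ω) := by
  refine measurable_of_measurableSet_le fun t => ?_
  have hset : {ω | hittingTime (fun s => Y (gridFloor Δ s) ω) ≤ t} =
      ⋃ k : ℕ, {ω | k * Δ ≤ t ∧ Y (k * Δ) ω ≤ 0} := by
    ext ω
    simp [hittingTime_gridFloor_le_iff hΔ (fun s => Y s ω)]
  rw [hset]
  exact MeasurableSet.iUnion fun k =>
    (MeasurableSet.const _).inter (measurableSet_le (hY _) measurable_const)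

end Stefan
namespace Stefan

/-! ### Solutions as fixed points of the loss operators -/

variable {Ω : Type*}

/-- `P(τ ≤ t)`, where `τ` is the hitting time of `(-∞, 0]` by `X₀ + Z_{g(s)} - α f_{g(s)}`. -/
noncomputable def lossOperator [MeasurableSpace Ω] (P : Measure Ω) (X₀ : Ω → ℝ)
    (Z : ℝ≥0 → Ω → ℝ) (α : ℝ) (g : ℝ≥0 → ℝ≥0) (f : ℝ≥0 → ℝ) (t : ℝ≥0) : ℝ :=
  P.real {ω | hittingTime (fun s => X₀ ω + Z (g s) ω - α * f (g s)) ≤ (t : ℝ≥0∞)}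

/-- The loss equation itself makes `α⁻¹ Λ` a distribution function, because `τ` is measurable. -/
theorem isMVSolution_iff [MeasurableSpace Ω] {P : Measure Ω} [IsProbabilityMeasure P]
    {X₀ : Ω → ℝ} {Z : ℝ≥0 → Ω → ℝ} {α : ℝ} (hα : 0 < α) (hX₀ : Measurable X₀)
    (hZ : ∀ t, Measurable (Z t)) (hZ_cont : ∀ ω, Continuous (fun t => Z t ω))
    (Λ : ℝ≥0 → ℝ) :
    (∃ X τ, IsMVSolution P X₀ Z α X τ Λ) ↔
      ∃ f, IsCdf f ∧ lossOperator P X₀ Z α id f = f ∧ ∀ t, Λ t = α * f t := by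
  constructor
  · rintro ⟨X, τ, h⟩
    refine ⟨fun t => P.real {ω | τ ω ≤ (t : ℝ≥0∞)}, isCdf_measureReal_le P h.measurable_hitting,
      ?_, h.loss_eq⟩
    funext t
    simp only [lossOperator, id, ← h.loss_eq]
    simp only [h.hitting_eq, h.state_eq]
  · rintro ⟨f, hf, hfix, hΛ⟩
    refine ⟨fun t ω => X₀ ω + Z t ω - Λ t, fun ω => hittingTime fun t => X₀ ω + Z t ω - Λ t,
      fun _ _ => rfl, fun _ => rfl, ?_, fun t => ?_⟩
    · simp only [hΛ]
      exact measurable_hittingTime hα (fun ω => continuous_const.add (hZ_cont ω))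
        (fun s => hX₀.add (hZ s)) hf
    · rw [hΛ, ← congrFun hfix t]
      simp only [lossOperator, id, hΛ]

theorem isDiscreteSolution_iff [MeasurableSpace Ω] {P : Measure Ω}
    {X₀ : Ω → ℝ} {Z : ℝ≥0 → Ω → ℝ} {α : ℝ} (hα : 0 < α) (Δ : ℝ≥0) (Λ : ℝ≥0 → ℝ) :
    IsDiscreteSolution P X₀ Z α Δ Λ ↔
      ∃ f, IsCdf f ∧ lossOperator P X₀ Z α (gridFloor Δ) f = f ∧ ∀ t, Λ t = α * f t := by
  constructor
  · rintro ⟨ℓ, hℓ, h⟩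
    have hΛ : ∀ t, Λ t = α * ℓ.val t := fun t => by
      rw [hℓ, mul_inv_cancel_left₀ hα.ne']
    exact ⟨ℓ.val, ℓ.isCdf_val, funext fun t => mul_left_cancel₀ hα.ne' ((h t).trans (hΛ t)), hΛ⟩
  · rintro ⟨f, hf, hfix, hΛ⟩
    refine ⟨hf.toDistFun, fun t => ?_, fun t => ?_⟩
    · rw [hf.toDistFun_val, hΛ, inv_mul_cancel_left₀ hα.ne']
    · rw [hΛ, ← congrFun hfix t, discreteGamma, hf.toDistFun_val]
      rfl

theorem isCdf_lossOperator_id [MeasurableSpace Ω] {P : Measure Ω} [IsProbabilityMeasure P]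
    {X₀ : Ω → ℝ} {Z : ℝ≥0 → Ω → ℝ} {α : ℝ} (hα : 0 < α) (hX₀ : Measurable X₀)
    (hZ : ∀ t, Measurable (Z t)) (hZ_cont : ∀ ω, Continuous (fun t => Z t ω))
    {f : ℝ≥0 → ℝ} (hf : IsCdf f) : IsCdf (lossOperator P X₀ Z α id f) :=
  isCdf_measureReal_le P (measurable_hittingTime hα (fun ω => continuous_const.add (hZ_cont ω))
    (fun s => hX₀.add (hZ s)) hf)

theorem isCdf_lossOperator_gridFloor [MeasurableSpace Ω] {P : Measure Ω} [IsProbabilityMeasure P]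
    {X₀ : Ω → ℝ} {Z : ℝ≥0 → Ω → ℝ} {α : ℝ} (hX₀ : Measurable X₀) (hZ : ∀ t, Measurable (Z t))
    {Δ : ℝ≥0} (hΔ : 0 < Δ) (f : ℝ≥0 → ℝ) :
    IsCdf (lossOperator P X₀ Z α (gridFloor Δ) f) :=
  isCdf_measureReal_le P (measurable_hittingTime_gridFloor hΔ
    (Y := fun s ω => X₀ ω + Z s ω - α * f s) fun s => (hX₀.add (hZ s)).sub_const _)

theorem lossOperator_mono [MeasurableSpace Ω] {P : Measure Ω} [IsFiniteMeasure P]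
    {X₀ : Ω → ℝ} {Z : ℝ≥0 → Ω → ℝ} {α : ℝ} (hα : 0 < α) (g : ℝ≥0 → ℝ≥0) {f f' : ℝ≥0 → ℝ}
    (h : f ≤ f') : lossOperator P X₀ Z α g f ≤ lossOperator P X₀ Z α g f' := fun _ =>
  measureReal_mono fun _ hω => (hittingTime_anti fun s =>
    sub_le_sub_left (mul_le_mul_of_nonneg_left (h (g s)) hα.le) _).trans hω

theorem lossOperator_gridFloor_le_id [MeasurableSpace Ω] {P : Measure Ω} [IsFiniteMeasure P]
    {X₀ : Ω → ℝ} {Z : ℝ≥0 → Ω → ℝ} {α : ℝ} {Δ : ℝ≥0} (hΔ : 0 < Δ) (f : ℝ≥0 → ℝ) :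
    lossOperator P X₀ Z α (gridFloor Δ) f ≤ lossOperator P X₀ Z α id f := fun t => by
  refine measureReal_mono fun ω hω => ?_
  obtain ⟨k, hkt, hk⟩ :=
    (hittingTime_gridFloor_le_iff hΔ (fun s => X₀ ω + Z s ω - α * f s) t).1 hω
  exact (hittingTime_le_of_le hk).trans (ENNReal.coe_le_coe.2 hkt)

theorem hittingTime_gridFloor_le_of_subset {Δ Δ' : ℝ≥0} (hΔ : 0 < Δ) (hΔ' : 0 < Δ')
    (h : Set.range (fun k : ℕ => (k : ℝ≥0) * Δ) ⊆ Set.range (fun k : ℕ => (k : ℝ≥0) * Δ'))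
    {x : ℝ≥0 → ℝ} {t : ℝ≥0} (ht : hittingTime (fun s => x (gridFloor Δ s)) ≤ t) :
    hittingTime (fun s => x (gridFloor Δ' s)) ≤ t := by
  obtain ⟨k, hkt, hk⟩ := (hittingTime_gridFloor_le_iff hΔ x t).1 ht
  obtain ⟨j, hj⟩ := h ⟨k, rfl⟩
  refine (hittingTime_gridFloor_le_iff hΔ' x t).2 ⟨j, ?_⟩
  rw [show (j : ℝ≥0) * Δ' = k * Δ from hj]
  exact ⟨hkt, hk⟩

/-! ### Crossing property and passage to the limit -/

/-- After its hitting time, a continuous process with the crossing property goes strictly below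
an increasing boundary within any positive time. -/
theorem CrossingProperty.ae_exists_lt [MeasurableSpace Ω] {P : Measure Ω}
    {X₀ : Ω → ℝ} {Z : ℝ≥0 → Ω → ℝ} {α : ℝ} (hα : 0 < α) {hX₀ : Measurable X₀}
    {hZ : ∀ t, Measurable (Z t)} (hZ_cont : ∀ ω, Continuous (fun t => Z t ω))
    (h_cross : CrossingProperty P X₀ Z hX₀ hZ) {f : ℝ≥0 → ℝ} (hf : IsCdf f) {h : ℝ≥0}
    (hh : 0 < h) :
    ∀ᵐ ω ∂P, ∀ t : ℝ≥0, hittingTime (fun s => X₀ ω + Z s ω - α * f s) ≤ t →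
      ∃ s ≤ t, ∃ r ≥ s, r ≤ s + h ∧ X₀ ω + Z r ω < α * f s := by
  have hcont : ∀ ω, Continuous fun s => X₀ ω + Z s ω := fun ω =>
    continuous_const.add (hZ_cont ω)
  let ℱ := Filtration.natural (fun t ω => X₀ ω + Z t ω)
    (fun t => (hX₀.add (hZ t)).stronglyMeasurable)
  have hτ : IsStoppingTime ℱ
      (fun ω => (hittingTime (fun s => X₀ ω + Z s ω - α * f s) : WithTop ℝ≥0)) := by
    intro t
    refine @measurableSet_hittingTime_le Ω (ℱ t) α hα (fun s ω => X₀ ω + Z s ω) hcont f hf t ?_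
    intro s hs
    have hm := (Filtration.stronglyAdapted_natural (u := fun t ω => X₀ ω + Z t ω)
      (fun t => (hX₀.add (hZ t)).stronglyMeasurable) s).measurable
    exact hm.mono (ℱ.mono hs) le_rfl
  filter_upwards [measure_eq_zero_iff_ae_notMem.1 (h_cross _ hτ h hh)] with ω hω t ht
  obtain ⟨T, hT⟩ := WithTop.ne_top_iff_exists.1 (ne_top_of_le_ne_top ENNReal.coe_ne_top ht)
  have hTt : T ≤ t := ENNReal.coe_le_coe.1 (hT.trans_le ht)
  have hxT : X₀ ω + Z T ω - α * f T ≤ 0 := by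
    obtain ⟨s, hsT, hs⟩ :=
      (hittingTime_le_iff (lowerSemicontinuous_sub hα (hcont ω) hf) T).1 hT.ge
    have hTs : T ≤ s := ENNReal.coe_le_coe.1
      (hT.trans_le (hittingTime_le_of_le (x := fun s => X₀ ω + Z s ω - α * f s) hs))
    rwa [le_antisymm hTs hsT]
  have hinf : ⨅ s : Set.Icc (0 : ℝ≥0) h, (Z (T + (s : ℝ≥0)) ω - Z T ω) ≠ 0 := fun h0 =>
    hω ⟨T, hT.symm, h0⟩
  -- Boundedness is needed because the real infimum of an unbounded family defaults to `0`. The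
  -- choice `s = 0` shows that the infimum is at most `0`, so being nonzero it is negative.
  have hbdd : BddBelow (Set.range fun s : Set.Icc (0 : ℝ≥0) h =>
      (Z (T + (s : ℝ≥0)) ω - Z T ω)) := by
    refine (isCompact_range ?_).bddBelow
    exact ((hZ_cont ω).comp (continuous_const.add continuous_subtype_val)).sub continuous_const
  have hle : ⨅ s : Set.Icc (0 : ℝ≥0) h, (Z (T + (s : ℝ≥0)) ω - Z T ω) ≤ 0 :=
    (ciInf_le hbdd ⟨0, le_rfl, hh.le⟩).trans (by simp)
  have : Nonempty (Set.Icc (0 : ℝ≥0) h) := ⟨⟨0, le_rfl, hh.le⟩⟩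
  obtain ⟨⟨s, hs⟩, hlt⟩ := exists_lt_of_ciInf_lt (lt_of_le_of_ne hle hinf)
  refine ⟨T, hTt, T + s, le_self_add, add_le_add_right hs.2 T, ?_⟩
  dsimp only at hlt
  linarith

theorem range_natCast_mul_mono {Δ : ℕ → ℝ≥0}
    (h : ∀ n, Set.range (fun k : ℕ => (k : ℝ≥0) * Δ n) ⊆
      Set.range (fun k : ℕ => (k : ℝ≥0) * Δ (n + 1))) :
    Monotone fun n => Set.range (fun k : ℕ => (k : ℝ≥0) * Δ n) :=
  monotone_nat_of_le_succ h

/-- The right-continuous modification of the limit of an increasing sequence of solutions along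
nested grids is a supersolution of the limiting problem. -/
theorem lossOperator_iInf_iSup_le [MeasurableSpace Ω] {P : Measure Ω} [IsProbabilityMeasure P]
    {X₀ : Ω → ℝ} {Z : ℝ≥0 → Ω → ℝ} {α : ℝ} (hα : 0 < α) {hX₀ : Measurable X₀}
    {hZ : ∀ t, Measurable (Z t)} (hZ_cont : ∀ ω, Continuous (fun t => Z t ω))
    (h_cross : CrossingProperty P X₀ Z hX₀ hZ) {Δ : ℕ → ℝ≥0} (hΔ_pos : ∀ n, 0 < Δ n)
    (hΔ_lim : Tendsto Δ atTop (𝓝 0))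
    (hΔ_nested : ∀ n, Set.range (fun k : ℕ => (k : ℝ≥0) * Δ n) ⊆
      Set.range (fun k : ℕ => (k : ℝ≥0) * Δ (n + 1)))
    {f : ℕ → ℝ≥0 → ℝ} (hf : ∀ n, IsCdf (f n)) (hf_mono : Monotone f)
    (hfix : ∀ n, lossOperator P X₀ Z α (gridFloor (Δ n)) (f n) = f n)
    (hlim : IsCdf fun t : ℝ≥0 => ⨅ u : Set.Ioi t, ⨆ n, f n (u : ℝ≥0)) :
    lossOperator P X₀ Z α id (fun t : ℝ≥0 => ⨅ u : Set.Ioi t, ⨆ n, f n (u : ℝ≥0)) ≤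
      fun t : ℝ≥0 => ⨅ u : Set.Ioi t, ⨆ n, f n (u : ℝ≥0) := by
  set F : ℝ≥0 → ℝ := fun t : ℝ≥0 => ⨅ u : Set.Ioi t, ⨆ n, f n (u : ℝ≥0) with hF
  have hbdd : ∀ t, BddAbove (Set.range fun n => f n t) := fun t =>
    ⟨1, by rintro _ ⟨n, rfl⟩; exact (hf n).le_one t⟩
  have hbb : ∀ t : ℝ≥0, BddBelow (Set.range fun u : Set.Ioi t => ⨆ n, f n (u : ℝ≥0)) := fun t =>
    ⟨0, by rintro _ ⟨u, rfl⟩; exact Real.iSup_nonneg fun n => (hf n).nonneg _⟩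
  intro t
  have : Nonempty (Set.Ioi t) := ⟨⟨t + 1, lt_add_one t⟩⟩
  refine le_ciInf fun ⟨u, htu⟩ => ?_
  -- Time up to `v` is left for the crossing, and from `v` to `u` for the next grid point.
  obtain ⟨v, htv, hvu⟩ := exists_between (show t < u from htu)
  let E : ℕ → Set Ω := fun n => {ω | hittingTime (fun s => X₀ ω + Z (gridFloor (Δ n) s) ω -
    α * f n (gridFloor (Δ n) s)) ≤ (u : ℝ≥0∞)}
  have hE_mono : Monotone E := by
    refine monotone_nat_of_le_succ fun n ω hω => ?_
    refine hittingTime_gridFloor_le_of_subset (x := fun s => X₀ ω + Z s ω - α * f (n + 1) s)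
      (hΔ_pos n) (hΔ_pos (n + 1)) (hΔ_nested n) (le_trans (hittingTime_anti fun s => ?_) hω)
    exact sub_le_sub_left (mul_le_mul_of_nonneg_left (hf_mono n.le_succ _) hα.le) _
  have hsub : {ω | hittingTime (fun s => X₀ ω + Z s ω - α * F s) ≤ (t : ℝ≥0∞)} ≤ᵐ[P]
      ⋃ n, E n := by
    filter_upwards [h_cross.ae_exists_lt hα hZ_cont hlim (tsub_pos_of_lt htv)] with ω hω ht
    obtain ⟨T, hTt, r, hTr, hr, hlt⟩ := hω t ht
    have hrv : r ≤ v := hr.trans (by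
      calc T + (v - t) ≤ t + (v - t) := add_le_add_left hTt _
        _ = v := add_tsub_cancel_of_le htv.le)
    have hev : ∀ᶠ q in 𝓝 r, X₀ ω + Z q ω < α * F T :=
      (continuous_const.add (hZ_cont ω)).continuousAt.eventually_lt_const hlt
    obtain ⟨w, hrw, hw⟩ := exists_Ico_subset_of_mem_nhds hev ⟨u, hrv.trans_lt hvu⟩
    have hru : r < min w u := lt_min hrw (hrv.trans_lt hvu)
    obtain ⟨n, hn⟩ := (hΔ_lim.eventually_lt_const (tsub_pos_of_lt hru)).exists
    obtain ⟨k, hk1, hk2⟩ := exists_natCast_mul_mem_Ioo (a := r) (hΔ_pos n)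
      (lt_tsub_iff_left.1 hn)
    have h1 : X₀ ω + Z (k * Δ n) ω < α * F T := hw ⟨hk1.le, hk2.trans_le (min_le_left _ _)⟩
    -- The grid point lies strictly after `T`, so it competes in the infimum defining `F T`.
    have h2 : F T ≤ ⨆ i, f i (k * Δ n) := ciInf_le (hbb T) ⟨k * Δ n, hTr.trans_lt hk1⟩
    obtain ⟨i, hi⟩ := exists_lt_of_lt_ciSup
      (((div_lt_iff₀' hα).2 h1).trans_le h2)
    -- At index `max n i` the grid still contains the point and the boundary is already high enough.
    obtain ⟨j, hj⟩ := range_natCast_mul_mono hΔ_nested (le_max_left n i) ⟨k, rfl⟩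
    replace hj : (j : ℝ≥0) * Δ (max n i) = k * Δ n := hj
    refine Set.mem_iUnion.2 ⟨max n i, (hittingTime_gridFloor_le_iff (hΔ_pos _)
      (fun s => X₀ ω + Z s ω - α * f (max n i) s) u).2 ⟨j, ?_⟩⟩
    rw [hj]
    refine ⟨(hk2.trans_le (min_le_right _ _)).le, ?_⟩
    have h3 := (div_lt_iff₀' hα).1 (hi.trans_le (hf_mono (le_max_right n i) (k * Δ n)))
    linarith
  have hP : P {ω | hittingTime (fun s => X₀ ω + Z s ω - α * F s) ≤ (t : ℝ≥0∞)} ≤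
      ENNReal.ofReal (⨆ n, f n u) := by
    refine (measure_mono_ae hsub).trans ?_
    rw [hE_mono.measure_iUnion]
    refine iSup_le fun n => ?_
    rw [← ofReal_measureReal]
    refine ENNReal.ofReal_le_ofReal (le_trans ?_ (le_ciSup (hbdd u) n))
    exact (congrFun (hfix n) u).le
  exact ENNReal.toReal_le_of_le_ofReal (Real.iSup_nonneg fun n => (hf n).nonneg u) hP

/-- An increasing sequence of distribution functions converges to the right-continuous
modification of its supremum at every continuity point of the latter. -/
theorem tendsto_of_continuousAt_iInf_iSup {ℓs : ℕ → DistFun} {ℓ : DistFun}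
    (hmono : Monotone fun n => (ℓs n).val) (hle : ∀ n, (ℓs n).val ≤ ℓ.val)
    (hge : ∀ t u : ℝ≥0, t < u → ℓ.val t ≤ ⨆ n, (ℓs n).val u) : ConvergesInM ℓs ℓ := by
  intro t ht0 ht
  induction t with
  | bot => exact absurd ht0 (not_le.2 EReal.bot_lt_zero)
  | top => simp only [DistFun.top_eq_one, tendsto_const_nhds_iff]
  | coe t =>
    lift t to ℝ≥0 using EReal.coe_nonneg.1 ht0
    have hbdd : BddAbove (Set.range fun n => (ℓs n).val t) :=
      ⟨ℓ.val t, by rintro _ ⟨n, rfl⟩; exact hle n t⟩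
    have hlim := tendsto_atTop_ciSup (fun i j hij => hmono hij t) hbdd
    suffices h : (⨆ n, (ℓs n).val t) = ℓ.val t by rwa [h] at hlim
    refine le_antisymm (ciSup_le fun n => hle n t) ?_
    -- Negative `s` are included so that the left limit at `t = 0` makes sense: continuity there
    -- forces `ℓ` to vanish at `0`.
    have hleft : ∀ s : EReal, s < ((t : ℝ) : EReal) → ℓ.toFun s ≤ ⨆ n, (ℓs n).val t := by
      intro s hs
      rcases lt_or_ge s 0 with hs0 | hs0
      · rw [ℓ.eq_zero_of_neg s hs0]
        exact Real.iSup_nonneg fun n => (ℓs n).isCdf_val.nonneg t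
      · induction s with
        | bot => exact absurd hs0 (not_le.2 EReal.bot_lt_zero)
        | top => exact absurd hs not_top_lt
        | coe s =>
          lift s to ℝ≥0 using EReal.coe_nonneg.1 hs0
          exact hge s t (NNReal.coe_lt_coe.1 (EReal.coe_lt_coe_iff.1 hs))
    have : (𝓝[<] ((t : ℝ) : EReal)).NeBot := 
      nhdsLT_neBot_of_exists_lt ⟨(⊥ : EReal), EReal.bot_lt_coe _⟩
    have hT : Tendsto ℓ.toFun (𝓝[<] ((t : ℝ) : EReal)) (𝓝 (ℓ.val t)) :=
      ht.tendsto.mono_left nhdsWithin_le_nhds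
    refine le_of_tendsto hT ?_
    filter_upwards [self_mem_nhdsWithin] with s hs using hleft s hs

/-! ### Minimal solutions and the main theorem -/

theorem isMinimalMVSolution_iff [MeasurableSpace Ω] {P : Measure Ω}
    {X₀ : Ω → ℝ} {Z : ℝ≥0 → Ω → ℝ} {α : ℝ} {Λ : ℝ≥0 → ℝ} :
    IsMinimalMVSolution P X₀ Z α Λ ↔ IsLeast {Λ | ∃ X τ, IsMVSolution P X₀ Z α X τ Λ} Λ :=
  and_congr_right fun _ => ⟨fun h _ ⟨X, τ, hs⟩ => h X τ _ hs, fun h X τ _ hs => h ⟨X, τ, hs⟩⟩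

theorem isMinimalDiscreteSolution_iff [MeasurableSpace Ω] {P : Measure Ω}
    {X₀ : Ω → ℝ} {Z : ℝ≥0 → Ω → ℝ} {α : ℝ} {Δ : ℝ≥0} {Λ : ℝ≥0 → ℝ} :
    IsMinimalDiscreteSolution P X₀ Z α Δ Λ ↔ IsLeast {Λ | IsDiscreteSolution P X₀ Z α Δ Λ} Λ :=
  and_congr_right fun _ => ⟨fun h _ hs => h _ hs, fun h _ hs => h hs⟩

theorem isLeast_mul_of_fixedPoint {Γ : (ℝ≥0 → ℝ) → ℝ≥0 → ℝ} {α : ℝ} (hα : 0 < α)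
    {f : ℝ≥0 → ℝ} (hf : IsCdf f) (hfix : Γ f = f) (hmin : ∀ g, IsCdf g → Γ g ≤ g → f ≤ g) :
    IsLeast {Λ : ℝ≥0 → ℝ | ∃ g, IsCdf g ∧ Γ g = g ∧ ∀ t, Λ t = α * g t} (fun t => α * f t) := by
  refine ⟨⟨f, hf, hfix, fun _ => rfl⟩, ?_⟩
  rintro Λ ⟨g, hg, hgfix, hΛ⟩ t
  rw [hΛ]
  exact mul_le_mul_of_nonneg_left (hmin g hg hgfix.le t) hα.le

end Stefan

theorem theorem2p8 {Ω : Type*} [MeasurableSpace Ω] (P : Measure Ω) [IsProbabilityMeasure P]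
    (X₀ : Ω → ℝ) (Z : ℝ≥0 → Ω → ℝ) (α : ℝ) (hα : 0 < α)
    (hX₀ : Measurable X₀) (hZ : ∀ t, Measurable (Z t))
    (hZ_cont : ∀ ω, Continuous (fun t => Z t ω)) (hZ_zero : ∀ ω, Z 0 ω = 0)
    (h_indep : IndepFun X₀ (fun ω t => Z t ω) P)
    (h_cross : Stefan.CrossingProperty P X₀ Z hX₀ hZ)
    (Δ : ℕ → ℝ≥0) (hΔ_pos : ∀ n, 0 < Δ n) (hΔ_lim : Tendsto Δ atTop (𝓝 0))
    (hΔ_nested : ∀ n, Set.range (fun k : ℕ => (k : ℝ≥0) * Δ n) ⊆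
      Set.range (fun k : ℕ => (k : ℝ≥0) * Δ (n + 1)))
    (h_atomless : (∀ x : ℝ, P.map X₀ {x} = 0) ∨ ∀ t, 0 < t → ∀ x : ℝ, P.map (Z t) {x} = 0) :
    (∃! Λ : ℝ≥0 → ℝ, Stefan.IsMinimalMVSolution P X₀ Z α Λ) ∧
    (∀ n, ∃! Λ : ℝ≥0 → ℝ, Stefan.IsMinimalDiscreteSolution P X₀ Z α (Δ n) Λ) ∧
    ∀ (Λ : ℝ≥0 → ℝ) (Λd : ℕ → ℝ≥0 → ℝ),
      Stefan.IsMinimalMVSolution P X₀ Z α Λ →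
      (∀ n, Stefan.IsMinimalDiscreteSolution P X₀ Z α (Δ n) (Λd n)) →
      ∃ (ℓ : Stefan.DistFun) (ℓd : ℕ → Stefan.DistFun),
        (∀ t, Λ t = α * ℓ.val t) ∧ (∀ n t, Λd n t = α * (ℓd n).val t) ∧
        Stefan.ConvergesInM ℓd ℓ := by
  have hcdf : ∀ f, Stefan.IsCdf f → Stefan.IsCdf (Stefan.lossOperator P X₀ Z α id f) :=
    fun f hf => Stefan.isCdf_lossOperator_id hα hX₀ hZ hZ_cont hf
  obtain ⟨f, hf, hfix, hmin⟩ := Stefan.exists_least_fixedPoint hcdf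
    fun g g' _ _ h => Stefan.lossOperator_mono hα _ h
  choose fd hfd hfdfix hfdmin using fun n => Stefan.exists_least_fixedPoint
    (Γ := Stefan.lossOperator P X₀ Z α (Stefan.gridFloor (Δ n)))
    (fun g _ => Stefan.isCdf_lossOperator_gridFloor hX₀ hZ (hΔ_pos n) g)
    fun g g' _ _ h => Stefan.lossOperator_mono hα _ h
  have hΛ : Stefan.IsMinimalMVSolution P X₀ Z α fun t => α * f t := by
    rw [Stefan.isMinimalMVSolution_iff]
    simp only [Stefan.isMVSolution_iff hα hX₀ hZ hZ_cont]
    exact Stefan.isLeast_mul_of_fixedPoint hα hf hfix hmin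
  have hΛd : ∀ n, Stefan.IsMinimalDiscreteSolution P X₀ Z α (Δ n) fun t => α * fd n t := by
    intro n
    rw [Stefan.isMinimalDiscreteSolution_iff]
    simp only [Stefan.isDiscreteSolution_iff hα]
    exact Stefan.isLeast_mul_of_fixedPoint hα (hfd n) (hfdfix n) (hfdmin n)
  have huniq : ∀ Λ, Stefan.IsMinimalMVSolution P X₀ Z α Λ → Λ = fun t => α * f t := fun Λ h =>
    (Stefan.isMinimalMVSolution_iff.1 h).unique (Stefan.isMinimalMVSolution_iff.1 hΛ)
  have huniqd : ∀ n Λ, Stefan.IsMinimalDiscreteSolution P X₀ Z α (Δ n) Λ →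
      Λ = fun t => α * fd n t := fun n Λ h =>
    (Stefan.isMinimalDiscreteSolution_iff.1 h).unique (Stefan.isMinimalDiscreteSolution_iff.1 (hΛd n))
  refine ⟨⟨_, hΛ, huniq⟩, fun n => ⟨_, hΛd n, huniqd n⟩, fun Λ Λd h hd => ?_⟩
  refine ⟨hf.toDistFun, fun n => (hfd n).toDistFun, fun t => ?_, fun n t => ?_, ?_⟩
  · rw [huniq Λ h, hf.toDistFun_val]
  · rw [huniqd n _ (hd n), (hfd n).toDistFun_val]
  have hfd_le : ∀ n, fd n ≤ f := fun n => hfdmin n f hf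
    ((Stefan.lossOperator_gridFloor_le_id (hΔ_pos n) f).trans hfix.le)
  have hfd_mono : Monotone fd := monotone_nat_of_le_succ fun n => by
    refine hfdmin n _ (hfd (n + 1)) (le_trans (fun t => ?_) (hfdfix (n + 1)).le)
    exact measureReal_mono fun ω hω => Stefan.hittingTime_gridFloor_le_of_subset
      (x := fun s => X₀ ω + Z s ω - α * fd (n + 1) s) (hΔ_pos n) (hΔ_pos (n + 1)) (hΔ_nested n) hω
  have hlim : Stefan.IsCdf fun t : ℝ≥0 => ⨅ u : Set.Ioi t, ⨆ n, fd n (u : ℝ≥0) :=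
    Stefan.isCdf_iInf_Ioi (m := fun u => ⨆ n, fd n u)
      (fun t => Real.iSup_nonneg fun n => (hfd n).nonneg t)
      fun t => ciSup_le fun n => (hfd n).le_one t
  -- The limit is only known to be a supersolution, so minimality among fixed points would not
  -- suffice.
  have hle := hmin _ hlim (Stefan.lossOperator_iInf_iSup_le hα hZ_cont h_cross hΔ_pos hΔ_lim
    hΔ_nested hfd hfd_mono hfdfix hlim)
  refine Stefan.tendsto_of_continuousAt_iInf_iSup ?_ (fun n => ?_) fun t u htu => ?_
  · simpa only [Stefan.IsCdf.toDistFun_val] using hfd_mono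
  · simpa only [Stefan.IsCdf.toDistFun_val] using hfd_le n
  · simp only [Stefan.IsCdf.toDistFun_val]
    refine (hle t).trans (ciInf_le ⟨0, ?_⟩ (⟨u, htu⟩ : Set.Ioi t))
    rintro _ ⟨v, rfl⟩
    exact Real.iSup_nonneg fun n => (hfd n).nonneg _
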